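/- All graphs are finite, simple and undirected. A \emph{unit interval graph} is the intersection graph of a family of closed intervals of length $1$ on the real line. A \emph{module} of $G=(V,E)$ is a set $M\subseteq V$ with $N(x)\setminus M=N(y)\setminus M$ for all $x,y\in M$; it is \emph{strong} if it overlaps no module (every module is disjoint from it, contains it or is contained in it). A graph is \emph{prime} if its only modules are $\emptyset$, the singletons and the whole vertex set. The \emph{modular decomposition tree} of $G$ has the nonempty strong modules as nodes, ordered by inclusion: the root is $V$, the leaves are the singletons, and the parent of a node is the least node properly containing it. The \emph{quotient} of an internal node $M$ is the graph on the children of $M$ in which two children are adjacent when $G$ has an edge between them; the node is \emph{series}, \emph{parallel} or \emph{prime} when the quotient is complete, edgeless, or a prime graph with at least four vertices. The \emph{depth} of the tree is the maximal number of edges on a path from the root to a leaf. Vertices $x\neq y$ are \emph{true twins} if $xy\in E$ and $N(x)\setminus\{y\}=N(y)\setminus\{x\}$; a \emph{true-twin class} is a class of the relation "equal or true twins". A \emph{balanced complement of a bipartite chain graph} is a graph whose vertex set is partitioned into two cliques $A,B$ of the same size with no two independent edges between them (no $a,a'\in A$, $b,b'\in B$ with $ab,a'b'\in E$ and $ab',a'b\notin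 E$). A \emph{clique node} is a leaf or a series node all of whose children are leaves. \textbf{Theorem.} Let $G$ be a unit interval graph. Then the modular decomposition tree of $G$ has depth at most $4$. If $G$ is disconnected, the root is a parallel node whose children are exactly the vertex sets of the connected components of $G$. The vertex set $X$ of every connected component of $G$ is a node of the tree of one of the following three types. \begin{enumerate} \item $X$ is a prime node, and each of its children is a true-twin class and a clique node. \item $X$ is a series node with a child $M$ such that $M$ is a prime node, the quotient of $M$ is a balanced complement of a bipartite chain graph, each child of $M$ is a true-twin class and a clique node, and all other children of $X$ are leaves, $X\setminus M$ being a clique. \item Either $X$ is a clique and a clique node, or $X$ is a clique with two false twins up to multiplying vertices into true twins, namely: $X$ is a series node with a child $P$ such that $P$ is a parallel node with exactly two children, each child of $P$ is a true-twin class and a clique node, and all other children of $X$ are leaves, $X\setminus P$ being a clique. \end{enumerate} -/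

import Mathlib

namespace SimpleGraph

variable {V : Type*}

/-- `G` is a unit interval graph: it is the intersection graph of a family of closed unit
intervals `[l v, l v + 1]` of the real line. -/
def IsUnitInterval (G : SimpleGraph V) : Prop :=
  ∃ l : V → ℝ, ∀ u v : V, u ≠ v →
    (G.Adj u v ↔ (Set.Icc (l u) (l u + 1) ∩ Set.Icc (l v) (l v + 1)).Nonempty)

/-- Distinct vertices `x`, `y` with `N(x) \ {y} = N(y) \ {x}` and `xy` an edge. -/
def IsTrueTwins (G : SimpleGraph V) (x y : V) : Prop :=
  x ≠ y ∧ G.neighborSet x \ {y} = G.neighborSet y \ {x} ∧ G.Adj x y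

/-- A class of the equivalence relation "equal or true twins". -/
def IsTrueTwinClass (G : SimpleGraph V) (S : Set V) : Prop :=
  ∃ v : V, S = {w | w = v ∨ G.IsTrueTwins v w}

/-- A module: all vertices of `M` have the same neighbourhood outside `M`. -/
def IsModule (G : SimpleGraph V) (M : Set V) : Prop :=
  ∀ x ∈ M, ∀ y ∈ M, G.neighborSet x \ M = G.neighborSet y \ M

/-- A prime graph: all its modules are trivial. -/
def IsPrimeGraph (G : SimpleGraph V) : Prop :=
  ∀ M : Set V, G.IsModule M → M = ∅ ∨ (∃ x, M = {x}) ∨ M = Set.univ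

/-- A strong module: a module that overlaps no other module. -/
def IsStrongModule (G : SimpleGraph V) (M : Set V) : Prop :=
  G.IsModule M ∧ ∀ N : Set V, G.IsModule N → Disjoint M N ∨ M ⊆ N ∨ N ⊆ M

/-! The modular decomposition tree of `G`: its nodes are the nonempty strong modules, the root is
the whole vertex set, the leaves are the singletons, and the parent of a node is the least node
that properly contains it. -/

/-- The nodes of the modular decomposition tree. -/
def IsMDNode (G : SimpleGraph V) (M : Set V) : Prop :=
  M.Nonempty ∧ G.IsStrongModule M

/-- `N` is a child of `M` in the modular decomposition tree. -/
def IsMDChild (G : SimpleGraph V) (N M : Set V) : Prop :=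
  G.IsMDNode N ∧ G.IsMDNode M ∧ N ⊂ M ∧ ∀ P : Set V, G.IsMDNode P → N ⊂ P → M ⊆ P

/-- The depth of a node: the number of its proper ancestors, that is, the number of edges of the
path from the root to the node. -/
noncomputable def mdNodeDepth (G : SimpleGraph V) (M : Set V) : ℕ∞ :=
  {P : Set V | G.IsMDNode P ∧ M ⊂ P}.encard

/-- The depth of the modular decomposition tree: the maximal number of edges of a path from the
root to a leaf. -/
noncomputable def mdDepth (G : SimpleGraph V) : ℕ∞ :=
  ⨆ (M : Set V) (_ : G.IsMDNode M), G.mdNodeDepth M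

/-- The quotient graph of a node `M`: its vertices are the children of `M`, and two distinct
children are adjacent when they are joined by an edge of `G` (children are disjoint modules, so
then all edges of `G` between them are present). -/
def mdQuotient (G : SimpleGraph V) (M : Set V) : SimpleGraph {N : Set V // G.IsMDChild N M} where
  Adj A B := A ≠ B ∧ ∃ a ∈ A.1, ∃ b ∈ B.1, G.Adj a b
  symm := ⟨fun _ _ ⟨hne, a, ha, b, hb, h⟩ => ⟨hne.symm, b, hb, a, ha, h.symm⟩⟩
  loopless := ⟨fun _ h => h.1 rfl⟩

/-- A leaf of the modular decomposition tree. -/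
def IsLeafNode (G : SimpleGraph V) (M : Set V) : Prop :=
  G.IsMDNode M ∧ ∃ v, M = {v}

/-- An internal node whose quotient graph has no edge. -/
def IsParallelNode (G : SimpleGraph V) (M : Set V) : Prop :=
  G.IsMDNode M ∧ M.Nontrivial ∧ G.mdQuotient M = ⊥

/-- An internal node whose quotient graph is complete. -/
def IsSeriesNode (G : SimpleGraph V) (M : Set V) : Prop :=
  G.IsMDNode M ∧ M.Nontrivial ∧ G.mdQuotient M = ⊤

/-- A node whose quotient graph is prime with at least four vertices (the prime graphs with fewer
vertices are complete or edgeless). -/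
def IsPrimeNode (G : SimpleGraph V) (M : Set V) : Prop :=
  G.IsMDNode M ∧ 4 ≤ {N : Set V | G.IsMDChild N M}.encard ∧ (G.mdQuotient M).IsPrimeGraph

/-- A balanced complement of a bipartite chain graph: the vertices are partitioned into two cliques
`A`, `B` of the same size with no two independent edges between them. -/
def IsBalancedCoBipartiteChain (G : SimpleGraph V) : Prop :=
  ∃ A B : Set V, A ∪ B = Set.univ ∧ Disjoint A B ∧ G.IsClique A ∧ G.IsClique B ∧
    A.encard = B.encard ∧
    ¬ ∃ a ∈ A, ∃ a' ∈ A, ∃ b ∈ B, ∃ b' ∈ B,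
      G.Adj a b ∧ G.Adj a' b' ∧ ¬ G.Adj a b' ∧ ¬ G.Adj a' b

/-- A clique node: a leaf, or a series node all of whose children are leaves. -/
def IsCliqueNode (G : SimpleGraph V) (M : Set V) : Prop :=
  G.IsLeafNode M ∨ (G.IsSeriesNode M ∧ ∀ N, G.IsMDChild N M → G.IsLeafNode N)

/-- A clique node whose vertices form a class of true twins. -/
def IsTwinNode (G : SimpleGraph V) (M : Set V) : Prop :=
  G.IsTrueTwinClass M ∧ G.IsCliqueNode M

/-- First type: a prime node whose children are true-twin classes. -/
def IsPrimeType (G : SimpleGraph V) (X : Set V) : Prop :=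
  G.IsPrimeNode X ∧ ∀ N, G.IsMDChild N X → G.IsTwinNode N

/-- Second type: a series node with one child `M` that is a prime node, whose quotient is a balanced
complement of a bipartite chain graph and whose children are true-twin classes; the other children
are leaves, and their vertices form a clique. -/
def IsSeriesPrimeType (G : SimpleGraph V) (X : Set V) : Prop :=
  G.IsSeriesNode X ∧ ∃ M, G.IsMDChild M X ∧
    (G.IsPrimeNode M ∧ (G.mdQuotient M).IsBalancedCoBipartiteChain ∧
      ∀ N, G.IsMDChild N M → G.IsTwinNode N) ∧
    (∀ N, G.IsMDChild N X → N ≠ M → G.IsLeafNode N) ∧ G.IsClique (X \ M)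

/-- Third type, second case: a series node with one child `P` that is a parallel node with exactly
two children, both of them true-twin classes; the other children are leaves, and their vertices form
a clique. -/
def IsFalseTwinType (G : SimpleGraph V) (X : Set V) : Prop :=
  G.IsSeriesNode X ∧ ∃ P, G.IsMDChild P X ∧
    (G.IsParallelNode P ∧ {N : Set V | G.IsMDChild N P}.encard = 2 ∧
      ∀ N, G.IsMDChild N P → G.IsTwinNode N) ∧
    (∀ N, G.IsMDChild N X → N ≠ P → G.IsLeafNode N) ∧ G.IsClique (X \ P)

/-- Third type: a clique, or a clique with two false twins up to multiplying vertices into true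
twins. -/
def IsCliqueType (G : SimpleGraph V) (X : Set V) : Prop :=
  (G.IsClique X ∧ G.IsCliqueNode X) ∨ G.IsFalseTwinType X

end SimpleGraph

namespace SimpleGraph

variable {V : Type*} {G : SimpleGraph V}

/-! ### Modules and the modular decomposition tree -/

/-! Fix left end points `l`, so that adjacency of distinct vertices means distance at most 1. Only
two obstructions are needed besides this metric description: no induced claw (`not_claw`) and no
induced 4-cycle (`not_square`). Let X be a component. If its complement is connected as well,
claw-freeness makes every proper submodule of X a clique (`isClique_of_isModule_ssubset`), hence
part of a true-twin class; so the children are the twin classes and the quotient is prime. If its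
complement is disconnected, the absence of 4-cycles leaves only one nontrivial co-component M, the
other vertices of X being universal in X. If M is connected it is prime as before, and a universal
vertex u cuts it into a left and a right clique, which have equally many twin classes because each
injects into the other through first non-neighbours (`exists_twin_reflecting_map`). If M is
disconnected, a claw at u is avoided only by two clique components. A leaf thus lies below at most a
twin class, M, X and the root, whence depth 4. -/

theorem isModule_iff {M : Set V} :
    G.IsModule M ↔ ∀ x ∈ M, ∀ y ∈ M, ∀ z ∉ M, G.Adj x z → G.Adj y z := by
  constructor
  · intro h x hx y hy z hz hxz
    have : z ∈ G.neighborSet x \ M := ⟨hxz, hz⟩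
    rw [h x hx y hy] at this
    exact this.1
  · intro h x hx y hy
    ext z
    exact ⟨fun hz => ⟨h x hx y hy z hz.2 hz.1, hz.2⟩, fun hz => ⟨h y hy x hx z hz.2 hz.1, hz.2⟩⟩

theorem IsModule.adj_iff {M : Set V} (h : G.IsModule M) {x y z : V} (hx : x ∈ M) (hy : y ∈ M)
    (hz : z ∉ M) : G.Adj x z ↔ G.Adj y z :=
  ⟨isModule_iff.1 h x hx y hy z hz, isModule_iff.1 h y hy x hx z hz⟩

theorem isModule_compl {M : Set V} : Gᶜ.IsModule M ↔ G.IsModule M := by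
  have key : ∀ H : SimpleGraph V, H.IsModule M → Hᶜ.IsModule M := by
    intro H h
    refine isModule_iff.2 fun x hx y hy z hz hxz => ?_
    rw [compl_adj] at hxz ⊢
    exact ⟨fun e => hz (e ▸ hy), fun e => hxz.2 ((h.adj_iff hx hy hz).2 e)⟩
  exact ⟨fun h => by simpa using key _ h, key G⟩

theorem isMDNode_compl {M : Set V} : Gᶜ.IsMDNode M ↔ G.IsMDNode M := by
  simp only [IsMDNode, IsStrongModule, isModule_compl]

theorem isMDChild_compl {N M : Set V} : Gᶜ.IsMDChild N M ↔ G.IsMDChild N M := by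
  simp only [IsMDChild, isMDNode_compl]

theorem isMDNode_univ [Nonempty V] : G.IsMDNode Set.univ :=
  ⟨Set.univ_nonempty, isModule_iff.2 fun _ _ _ _ z hz => absurd (Set.mem_univ z) hz,
    fun N _ => Or.inr (Or.inr (Set.subset_univ N))⟩

theorem IsMDNode.subset_or_subset {M N : Set V} (hM : G.IsMDNode M) (hN : G.IsModule N) {x : V}
    (hxM : x ∈ M) (hxN : x ∈ N) : M ⊆ N ∨ N ⊆ M :=
  (hM.2.2 N hN).resolve_left fun h => Set.disjoint_left.1 h hxM hxN

theorem IsMDChild.subset_of_mem {N M P : Set V} (h : G.IsMDChild N M) (hP : G.IsMDNode P)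
    (hPM : P ⊂ M) {x : V} (hxN : x ∈ N) (hxP : x ∈ P) : P ⊆ N := by
  rcases h.1.subset_or_subset hP.2.1 hxN hxP with h1 | h1
  · rcases h1.eq_or_ssubset with h2 | h2
    · exact h2.symm.subset
    · exact absurd (h.2.2.2 P hP h2) hPM.2
  · exact h1

theorem IsMDChild.eq_of_mem {N N' M : Set V} (h : G.IsMDChild N M) (h' : G.IsMDChild N' M) {x : V}
    (hx : x ∈ N) (hx' : x ∈ N') : N = N' :=
  (h'.subset_of_mem h.1 h.2.2.1 hx' hx).antisymm (h.subset_of_mem h'.1 h'.2.2.1 hx hx')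

theorem exists_isMDChild_of_ssubset [Finite V] {P Q : Set V} (hP : G.IsMDNode P)
    (hQ : G.IsMDNode Q) (hPQ : P ⊂ Q) : ∃ C, G.IsMDChild C Q ∧ P ⊆ C := by
  obtain ⟨C, hPC, hC⟩ := (Set.toFinite {C : Set V | G.IsMDNode C ∧ C ⊂ Q}).exists_le_maximal
    (a := P) ⟨hP, hPQ⟩
  refine ⟨C, ⟨hC.prop.1, hQ, hC.prop.2, fun R hR hCR => ?_⟩, hPC⟩
  obtain ⟨x, hx⟩ := hP.1
  have hxC : x ∈ C := hPC hx
  rcases hQ.subset_or_subset hR.2.1 (hC.prop.2.1 hxC) (hCR.1 hxC) with h | h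
  · exact h
  · rcases h.eq_or_ssubset with h1 | h1
    · exact h1.symm.subset
    · exact absurd (hC.le_of_ge ⟨hR, h1⟩ hCR.1) hCR.2

theorem mdQuotient_adj_iff {M : Set V} {A B : {N : Set V // G.IsMDChild N M}} (hAB : A ≠ B)
    {x y : V} (hx : x ∈ A.1) (hy : y ∈ B.1) : (G.mdQuotient M).Adj A B ↔ G.Adj x y := by
  have hdisj : ∀ z, z ∈ A.1 → z ∉ B.1 := fun z h h' =>
    hAB (Subtype.ext (A.2.eq_of_mem B.2 h h'))
  constructor
  · rintro ⟨-, a, ha, b, hb, hab⟩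
    have h1 := (A.2.1.2.1.adj_iff ha hx (fun h => hdisj b h hb)).1 hab
    exact ((B.2.1.2.1.adj_iff hb hy (hdisj x hx)).1 h1.symm).symm
  · exact fun h => ⟨hAB, x, hx, y, hy, h⟩

/-- The internal nodes of the tree contained in `Q` and containing `x`. -/
def mdAncestorsIn (G : SimpleGraph V) (x : V) (Q : Set V) : Set (Set V) :=
  {P | G.IsMDNode P ∧ {x} ⊂ P ∧ P ⊆ Q}

/-- Besides `Q` itself, every node counted lies inside the one child of `Q` that contains `x`. -/
theorem encard_mdAncestorsIn_le [Finite V] {x : V} {Q : Set V} {k : ℕ∞} (hQ : G.IsMDNode Q)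
    (h : ∀ C, G.IsMDChild C Q → x ∈ C → (G.mdAncestorsIn x C).encard ≤ k) :
    (G.mdAncestorsIn x Q).encard ≤ k + 1 := by
  by_cases hC : ∃ C, G.IsMDChild C Q ∧ x ∈ C
  · obtain ⟨C, hC, hx⟩ := hC
    have hsub : G.mdAncestorsIn x Q ⊆ insert Q (G.mdAncestorsIn x C) := by
      rintro P ⟨hP, hxP, hPQ⟩
      rcases hPQ.eq_or_ssubset with h1 | h1
      · exact Or.inl h1
      · exact Or.inr ⟨hP, hxP, hC.subset_of_mem hP h1 hx (hxP.1 rfl)⟩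
    calc _ ≤ _ := Set.encard_le_encard hsub
      _ ≤ _ := Set.encard_insert_le _ _
      _ ≤ k + 1 := by gcongr; exact h C hC hx
  · have hsub : G.mdAncestorsIn x Q ⊆ {Q} := by
      rintro P ⟨hP, hxP, hPQ⟩
      rcases hPQ.eq_or_ssubset with h1 | h1
      · exact h1
      · obtain ⟨C, hC', hPC⟩ := exists_isMDChild_of_ssubset hP hQ h1
        exact absurd ⟨C, hC', hPC (hxP.1 rfl)⟩ hC
    calc _ ≤ _ := Set.encard_le_encard hsub
      _ = 1 := Set.encard_singleton _
      _ ≤ k + 1 := le_add_self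

theorem encard_mdAncestorsIn_leaf {x : V} {Q : Set V} (h : G.IsLeafNode Q) :
    (G.mdAncestorsIn x Q).encard ≤ 0 := by
  obtain ⟨-, v, rfl⟩ := h
  simp only [nonpos_iff_eq_zero, Set.encard_eq_zero, Set.eq_empty_iff_forall_notMem]
  rintro P ⟨-, h1, h2⟩
  have hx : x = v := h2 (h1.1 rfl)
  subst hx
  exact h1.2 h2

theorem encard_mdAncestorsIn_cliqueNode [Finite V] {x : V} {Q : Set V} (h : G.IsCliqueNode Q) :
    (G.mdAncestorsIn x Q).encard ≤ 1 := by
  rcases h with h | h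
  · exact (encard_mdAncestorsIn_leaf h).trans zero_le_one
  · simpa using encard_mdAncestorsIn_le h.1.1 (k := 0)
      fun C hC _ => encard_mdAncestorsIn_leaf (h.2 C hC)

theorem encard_mdAncestorsIn_of_type [Finite V] {x : V} {X : Set V}
    (h : G.IsPrimeType X ∨ G.IsSeriesPrimeType X ∨ G.IsCliqueType X) :
    (G.mdAncestorsIn x X).encard ≤ 3 := by
  -- The three possible ancestors are `X`, its exceptional child `M` and a clique node below `M`.
  have step : ∀ {X M : Set V}, G.IsMDNode X → G.IsMDNode M →
      (∀ N, G.IsMDChild N M → G.IsTwinNode N) →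
      (∀ N, G.IsMDChild N X → N ≠ M → G.IsLeafNode N) → (G.mdAncestorsIn x X).encard ≤ 3 := by
    intro X M hX hM hMt hXl
    refine encard_mdAncestorsIn_le (k := 2) hX fun C hC _ => ?_
    by_cases hCM : C = M
    · subst hCM
      exact encard_mdAncestorsIn_le (k := 1) hM
        fun D hD _ => encard_mdAncestorsIn_cliqueNode (hMt D hD).2
    · exact (encard_mdAncestorsIn_leaf (hXl C hC hCM)).trans (by norm_num)
  rcases h with h | h | h | h
  · have := encard_mdAncestorsIn_le (x := x) (k := 1) h.1.1
      fun D hD _ => encard_mdAncestorsIn_cliqueNode (h.2 D hD).2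
    exact this.trans (by norm_num)
  · obtain ⟨hX, M, -, ⟨hM, -, hMt⟩, hl, -⟩ := h
    exact step hX.1 hM.1 hMt hl
  · exact (encard_mdAncestorsIn_cliqueNode h.2).trans (by norm_num)
  · obtain ⟨hX, M, -, ⟨hM, -, hMt⟩, hl, -⟩ := h
    exact step hX.1 hM.1 hMt hl

/-- The proper ancestors of a node are also proper ancestors of each leaf below it. -/
theorem mdDepth_le [Finite V] {k : ℕ∞} (h : ∀ x, (G.mdAncestorsIn x Set.univ).encard ≤ k) :
    G.mdDepth ≤ k := by
  refine iSup₂_le fun M hM => ?_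
  obtain ⟨x, hx⟩ := hM.1
  refine (Set.encard_le_encard ?_).trans (h x)
  rintro P ⟨hP, hMP⟩
  exact ⟨hP, (Set.singleton_subset_iff.2 hx).trans_ssubset hMP, Set.subset_univ _⟩

/-! ### Connectivity of vertex sets -/

/-- Every cut of the vertex set `X` is crossed by an edge. -/
def CutConnected (G : SimpleGraph V) (X : Set V) : Prop :=
  ∀ S ⊆ X, S.Nonempty → (X \ S).Nonempty → ∃ a ∈ S, ∃ b ∈ X \ S, G.Adj a b

theorem cutConnected_of_isClique {X : Set V} (h : G.IsClique X) : G.CutConnected X := by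
  rintro S hS ⟨a, ha⟩ ⟨b, hb⟩
  exact ⟨a, ha, b, hb, h (hS ha) hb.1 fun e => hb.2 (e ▸ ha)⟩

theorem ConnectedComponent.cutConnected_supp (C : G.ConnectedComponent) :
    G.CutConnected C.supp := by
  rintro S hS ⟨a, ha⟩ ⟨b, hb, hbS⟩
  have hab : G.Reachable a b := ConnectedComponent.exact ((hS ha).trans hb.symm)
  obtain ⟨w⟩ := hab
  obtain ⟨d, -, h1, h2⟩ := w.exists_boundary_dart S ha hbS
  refine ⟨d.fst, h1, d.snd, ⟨?_, h2⟩, d.adj⟩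
  exact (ConnectedComponent.mem_supp_congr_adj C d.adj).1 (hS h1)

/-- Both `C` and `X \ C` are modules. A node properly containing `C` meets `X \ C`, is comparable
with that module, and so contains all of `X`. -/
theorem IsMDNode.isMDChild_of_no_edge {X C : Set V} (hX : G.IsMDNode X) (hC : C.Nonempty)
    (hCX : C ⊂ X) (hconn : G.CutConnected C) (hno : ∀ a ∈ C, ∀ b ∈ X \ C, ¬ G.Adj a b) :
    G.IsMDChild C X := by
  have hmod : G.IsModule C := by
    refine isModule_iff.2 fun x hx y hy z hz hxz => ?_
    by_cases hzX : z ∈ X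
    · exact absurd hxz (hno x hx z ⟨hzX, hz⟩)
    · exact (hX.2.1.adj_iff (hCX.1 hx) (hCX.1 hy) hzX).1 hxz
  have hmod' : G.IsModule (X \ C) := by
    refine isModule_iff.2 fun x hx y hy z hz hxz => ?_
    by_cases hzX : z ∈ X
    · have hzC : z ∈ C := by by_contra h; exact hz ⟨hzX, h⟩
      exact absurd hxz.symm (hno z hzC x hx)
    · exact (hX.2.1.adj_iff hx.1 hy.1 hzX).1 hxz
  have hstrong : G.IsStrongModule C := by
    refine ⟨hmod, fun N hN => ?_⟩
    by_contra! hcon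
    obtain ⟨h1, h2, h3⟩ := hcon
    obtain ⟨c, hcC, hcN⟩ := Set.not_disjoint_iff.1 h1
    rcases hX.subset_or_subset hN (hCX.1 hcC) hcN with h | h
    · exact h2 (hCX.1.trans h)
    · obtain ⟨y, hyN, hyC⟩ := Set.not_subset.1 h3
      obtain ⟨z, hzC, hzN⟩ := Set.not_subset.1 h2
      -- If `N` overlaps `C`, an edge of `C` leaves `N`; the module property of `N` carries it to
      -- `y`, giving a forbidden edge between `C` and `X \ C`.
      obtain ⟨a, ha, b, hb, hab⟩ := hconn (C ∩ N) Set.inter_subset_left ⟨c, hcC, hcN⟩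
        ⟨z, hzC, fun h => hzN h.2⟩
      have hbN : b ∉ N := fun h => hb.2 ⟨hb.1, h⟩
      exact hno b hb.1 y ⟨h hyN, hyC⟩ ((hN.adj_iff ha.2 hyN hbN).1 hab).symm
  refine ⟨⟨hC, hstrong⟩, hX, hCX, fun P hP hCP => ?_⟩
  obtain ⟨c, hc⟩ := hC
  obtain ⟨p, hpP, hpC⟩ := Set.not_subset.1 hCP.2
  rcases hX.subset_or_subset hP.2.1 (hCX.1 hc) (hCP.1 hc) with h | h
  · exact h
  · rcases hP.subset_or_subset hmod' hpP ⟨h hpP, hpC⟩ with h' | h'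
    · exact absurd hc (h' (hCP.1 hc)).2
    · intro x hx
      by_cases hxC : x ∈ C
      · exact hCP.1 hxC
      · exact h' ⟨hx, hxC⟩

theorem IsMDNode.isMDChild_of_all_edges {X C : Set V} (hX : G.IsMDNode X) (hC : C.Nonempty)
    (hCX : C ⊂ X) (hconn : Gᶜ.CutConnected C) (hall : ∀ a ∈ C, ∀ b ∈ X \ C, G.Adj a b) :
    G.IsMDChild C X :=
  isMDChild_compl.1 <| (isMDNode_compl.2 hX).isMDChild_of_no_edge hC hCX hconn
    fun a ha b hb h => h.2 (hall a ha b hb)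

theorem isMDChild_supp_univ (hG : ¬ G.Preconnected) (C : G.ConnectedComponent) :
    G.IsMDChild C.supp Set.univ := by
  have : Nonempty V := ⟨C.nonempty_supp.some⟩
  refine isMDNode_univ.isMDChild_of_no_edge C.nonempty_supp ?_ C.cutConnected_supp ?_
  · refine (Set.ssubset_univ_iff).2 fun h => hG fun u v => ConnectedComponent.exact ?_
    have hu : u ∈ C.supp := h ▸ Set.mem_univ u
    have hv : v ∈ C.supp := h ▸ Set.mem_univ v
    exact Eq.trans hu (Eq.symm hv)
  · exact fun a ha b hb hab => hb.2 ((ConnectedComponent.mem_supp_congr_adj C hab).1 ha)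

theorem isMDChild_univ_iff (hG : ¬ G.Preconnected) {N : Set V} :
    G.IsMDChild N Set.univ ↔ ∃ C : G.ConnectedComponent, N = C.supp := by
  constructor
  · intro h
    obtain ⟨x, hx⟩ := h.1.1
    exact ⟨G.connectedComponentMk x, h.eq_of_mem (isMDChild_supp_univ hG _) hx rfl⟩
  · rintro ⟨C, rfl⟩
    exact isMDChild_supp_univ hG C

theorem isParallelNode_univ (hG : ¬ G.Preconnected) : G.IsParallelNode Set.univ := by
  obtain ⟨u, v, huv⟩ : ∃ u v, ¬ G.Reachable u v := by simpa [Preconnected] using hG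
  have : Nonempty V := ⟨u⟩
  refine ⟨isMDNode_univ, ⟨u, trivial, v, trivial, fun e => huv (e ▸ Reachable.refl u)⟩, ?_⟩
  ext ⟨A, hA⟩ ⟨B, hB⟩
  simp only [bot_adj, iff_false]
  intro h
  obtain ⟨hne, a, ha, b, hb, hab⟩ := id h
  obtain ⟨C, rfl⟩ := (isMDChild_univ_iff hG).1 hA
  exact hne (Subtype.ext (hA.eq_of_mem hB
    ((ConnectedComponent.mem_supp_congr_adj C hab).1 ha) hb))

theorem isMDNode_supp (C : G.ConnectedComponent) : G.IsMDNode C.supp := by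
  by_cases hG : G.Preconnected
  · have : Nonempty V := ⟨C.nonempty_supp.some⟩
    obtain ⟨x, hx⟩ := C.nonempty_supp
    have : C.supp = Set.univ :=
      Set.eq_univ_of_forall fun y => (ConnectedComponent.sound (hG y x)).trans hx
    rw [this]
    exact isMDNode_univ
  · exact (isMDChild_supp_univ hG C).1

/-! ### Cliques and true twins -/

/-- Every subset of `K` is a module, so a child with two elements would be overlapped by a pair with
one element in it and one outside. -/
theorem IsMDNode.isCliqueNode {K : Set V} (hK : G.IsMDNode K) (hc : G.IsClique K) :
    G.IsCliqueNode K := by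
  by_cases hn : K.Nontrivial
  swap
  · obtain ⟨v, hv⟩ := hK.1
    exact Or.inl ⟨hK, v, (Set.not_nontrivial_iff.1 hn).eq_singleton_of_mem hv⟩
  have hmod : ∀ S ⊆ K, G.IsModule S := by
    intro S hS
    refine isModule_iff.2 fun x hx y hy z hz hxz => ?_
    by_cases hzK : z ∈ K
    · exact hc (hS hy) hzK fun e => hz (e ▸ hy)
    · exact (hK.2.1.adj_iff (hS hx) (hS hy) hzK).1 hxz
  refine Or.inr ⟨⟨hK, hn, ?_⟩, fun N hN => ⟨hN.1, ?_⟩⟩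
  · ext A B
    rw [top_adj]
    refine ⟨fun h => h.ne, fun hAB => ?_⟩
    obtain ⟨a, ha⟩ := A.2.1.1
    obtain ⟨b, hb⟩ := B.2.1.1
    refine (mdQuotient_adj_iff hAB ha hb).2 (hc (A.2.2.2.1.1 ha) (B.2.2.2.1.1 hb) ?_)
    rintro rfl
    exact hAB (Subtype.ext (A.2.eq_of_mem B.2 ha hb))
  · obtain ⟨x, hx⟩ := hN.1.1
    refine ⟨x, Set.Subset.antisymm (fun y hy => ?_) (Set.singleton_subset_iff.2 hx)⟩
    by_contra hyx
    obtain ⟨z, hzK, hzN⟩ := Set.not_subset.1 hN.2.2.1.2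
    have hm : G.IsModule {x, z} :=
      hmod _ (Set.insert_subset (hN.2.2.1.1 hx) (Set.singleton_subset_iff.2 hzK))
    rcases hN.1.subset_or_subset hm hx (Set.mem_insert _ _) with h | h
    · rcases h hy with h | h
      · exact hyx h
      · exact hzN (Set.mem_singleton_iff.1 h ▸ hy)
    · exact hzN (h (by simp))

/-- The class of `v` for the relation "equal or true twins". -/
def trueTwinClass (G : SimpleGraph V) (v : V) : Set V := {w | w = v ∨ G.IsTrueTwins v w}

theorem isTrueTwinClass_trueTwinClass (v : V) : G.IsTrueTwinClass (G.trueTwinClass v) := ⟨v, rfl⟩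

/-- In terms of closed neighbourhoods the relation is an equality, which makes symmetry and
transitivity immediate. -/
theorem mem_trueTwinClass_iff {v w : V} :
    w ∈ G.trueTwinClass v ↔ ∀ z, (z = v ∨ G.Adj v z) ↔ (z = w ∨ G.Adj w z) := by
  constructor
  · rintro (rfl | ⟨hne, hN, hadj⟩) z
    · rfl
    · have := Set.ext_iff.1 hN z
      simp only [Set.mem_sdiff, mem_neighborSet, Set.mem_singleton_iff] at this
      by_cases h1 : z = v
      · subst h1; simp [hadj.symm]
      · by_cases h2 : z = w
        · subst h2; simp [hadj]
        · tauto
  · intro h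
    by_cases hwv : w = v
    · exact Or.inl hwv
    · have hadj : G.Adj v w := ((h w).2 (Or.inl rfl)).resolve_left hwv
      refine Or.inr ⟨Ne.symm hwv, ?_, hadj⟩
      ext z
      have := h z
      have h3 : G.Adj v z → z ≠ v := fun h => h.ne'
      have h4 : G.Adj w z → z ≠ w := fun h => h.ne'
      simp only [Set.mem_sdiff, mem_neighborSet, Set.mem_singleton_iff]
      tauto

theorem mem_trueTwinClass_self (v : V) : v ∈ G.trueTwinClass v := Or.inl rfl

theorem trueTwinClass_eq {v w : V} (h : w ∈ G.trueTwinClass v) :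
    G.trueTwinClass w = G.trueTwinClass v := by
  ext z
  rw [mem_trueTwinClass_iff] at h
  simp only [mem_trueTwinClass_iff, h]

theorem adj_iff_of_mem_trueTwinClass {v w z : V} (h : w ∈ G.trueTwinClass v) (h1 : z ≠ v)
    (h2 : z ≠ w) : G.Adj v z ↔ G.Adj w z := by
  simpa [h1, h2] using mem_trueTwinClass_iff.1 h z

theorem isModule_trueTwinClass (v : V) : G.IsModule (G.trueTwinClass v) := by
  refine isModule_iff.2 fun x hx y hy z hz hxz => ?_
  have hy' : y ∈ G.trueTwinClass x := trueTwinClass_eq hx ▸ hy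
  exact (adj_iff_of_mem_trueTwinClass hy' hxz.ne' fun e => hz (e ▸ hy)).1 hxz

theorem isClique_trueTwinClass (v : V) : G.IsClique (G.trueTwinClass v) := by
  intro x hx y hy hxy
  have hy' : y ∈ G.trueTwinClass x := trueTwinClass_eq hx ▸ hy
  exact (hy'.resolve_left hxy.symm).2.2

theorem IsModule.subset_trueTwinClass {N : Set V} (hN : G.IsModule N) (hc : G.IsClique N) {v : V}
    (hv : v ∈ N) : N ⊆ G.trueTwinClass v := by
  intro w hw
  rw [mem_trueTwinClass_iff]
  intro z
  by_cases hz : z ∈ N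
  · have h1 : z = v ∨ G.Adj v z := or_iff_not_imp_left.2 fun h => hc hv hz (Ne.symm h)
    have h2 : z = w ∨ G.Adj w z := or_iff_not_imp_left.2 fun h => hc hw hz (Ne.symm h)
    simp [h1, h2]
  · have h1 : z ≠ v := fun e => hz (e ▸ hv)
    have h2 : z ≠ w := fun e => hz (e ▸ hw)
    simp [h1, h2, hN.adj_iff hv hw hz]

/-! ### Unit interval representations -/

/-- `l` gives the left end points of a unit interval representation of `G`. -/
def IsUnitRep (G : SimpleGraph V) (l : V → ℝ) : Prop :=
  ∀ u v : V, G.Adj u v ↔ u ≠ v ∧ |l u - l v| ≤ 1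

theorem IsUnitInterval.exists_isUnitRep (hG : G.IsUnitInterval) : ∃ l, G.IsUnitRep l := by
  obtain ⟨l, hl⟩ := hG
  refine ⟨l, fun u v => ?_⟩
  by_cases huv : u = v
  · subst huv; simp
  rw [hl u v huv, Set.Icc_inter_Icc, Set.nonempty_Icc, sup_le_iff, le_inf_iff, le_inf_iff, abs_le]
  simp only [ne_eq, huv, not_false_eq_true, true_and]
  constructor
  · rintro ⟨⟨-, h1⟩, h2, -⟩
    constructor <;> linarith
  · rintro ⟨h1, h2⟩
    refine ⟨⟨?_, ?_⟩, ?_, ?_⟩ <;> linarith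

namespace IsUnitRep

variable {l : V → ℝ}

theorem neg (hl : G.IsUnitRep l) : G.IsUnitRep (fun v => -l v) := by
  intro u v
  rw [hl u v, show -l u - -l v = -(l u - l v) by ring, abs_neg]

theorem mem_trueTwinClass_iff (hl : G.IsUnitRep l) {v w : V} :
    w ∈ G.trueTwinClass v ↔ ∀ z, |l v - l z| ≤ 1 ↔ |l w - l z| ≤ 1 := by
  have key : ∀ v z, (z = v ∨ G.Adj v z) ↔ |l v - l z| ≤ 1 := by
    intro v z
    by_cases h : z = v
    · subst h; simp
    · simp [h, hl v z, Ne.symm h]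
  simp only [SimpleGraph.mem_trueTwinClass_iff, key]

/-- Of three points pairwise more than 1 apart the outer two are more than 2 apart, so they cannot
both be within 1 of `l w`. -/
theorem not_claw (hl : G.IsUnitRep l) {w x y z : V} (hx : G.Adj w x) (hy : G.Adj w y)
    (hz : G.Adj w z) (hxy : x ≠ y) (hxz : x ≠ z) (hyz : y ≠ z) :
    G.Adj x y ∨ G.Adj x z ∨ G.Adj y z := by
  simp only [hl _ _, abs_le] at *
  by_contra! h
  obtain ⟨h1, h2, h3⟩ := h
  have h1 := h1 hxy
  have h2 := h2 hxz
  have h3 := h3 hyz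
  grind

/-- If `l a` and `l a'` are more than 1 apart, the points within 1 of both fill an interval of
length less than 1. -/
theorem not_square (hl : G.IsUnitRep l) {a a' b b' : V} (h1 : G.Adj a b) (h2 : G.Adj a b')
    (h3 : G.Adj a' b) (h4 : G.Adj a' b') (ha : a ≠ a') (hb : b ≠ b') :
    G.Adj a a' ∨ G.Adj b b' := by
  simp only [hl _ _, abs_le] at *
  by_contra! h
  obtain ⟨h5, h6⟩ := h
  have h5 := h5 ha
  have h6 := h6 hb
  grind

/-! ### Connected and co-connected nodes -/

theorem exists_not_adj {M : Set V} (hco : Gᶜ.CutConnected M)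
    (hnt : M.Nontrivial) {x : V} (hx : x ∈ M) : ∃ y ∈ M, y ≠ x ∧ ¬ G.Adj x y := by
  obtain ⟨z, hz, hzx⟩ := hnt.exists_ne x
  obtain ⟨a, rfl, b, hb, hab⟩ := hco {x} (Set.singleton_subset_iff.2 hx) (Set.singleton_nonempty x)
    ⟨z, hz, hzx⟩
  exact ⟨b, hb.1, hb.2, ((compl_adj _ _ _).1 hab).2⟩

/-- Split `M \ N` into neighbours and non-neighbours of `N`. Connectivity makes the first part
nonempty, co-connectivity then the second, and connectivity again yields an edge `ab` from the
second to the first. Nonadjacent `u`, `v` in `N` would form a claw with `a`, centred at `b`. -/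
theorem isClique_of_isModule_ssubset (hl : G.IsUnitRep l) {M N : Set V}
    (hconn : G.CutConnected M) (hco : Gᶜ.CutConnected M) (hN : G.IsModule N) (hNM : N ⊂ M) :
    G.IsClique N := by
  intro u hu v hv huv
  by_contra hadj
  obtain ⟨y, hyM, hyN⟩ := Set.not_subset.1 hNM.2
  obtain ⟨n, hn, w, hw, hnw⟩ := hconn N hNM.1 ⟨u, hu⟩ ⟨y, hyM, hyN⟩
  obtain ⟨r, hr, z, hz, hrz⟩ := hco {z | z ∈ M \ N ∧ G.Adj u z} (fun z hz => hz.1.1)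
    ⟨w, hw, (hN.adj_iff hu hn hw.2).2 hnw⟩ ⟨u, hNM.1 hu, fun h => h.1.2 hu⟩
  have hzN : z ∉ N := fun h =>
    ((compl_adj _ _ _).1 hrz).2 ((hN.adj_iff hu h hr.1.2).1 hr.2).symm
  have hzu : ¬ G.Adj u z := fun h => hz.2 ⟨⟨hz.1, hzN⟩, h⟩
  obtain ⟨a, ha, b, hb, hab⟩ := hconn {z | z ∈ M \ N ∧ ¬ G.Adj u z} (fun z hz => hz.1.1)
    ⟨z, ⟨hz.1, hzN⟩, hzu⟩ ⟨u, hNM.1 hu, fun h => h.1.2 hu⟩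
  have hbN : b ∉ N := fun h => ha.2 ((hN.adj_iff h hu ha.1.2).1 hab.symm)
  have hub : G.Adj u b := by
    by_contra h
    exact hb.2 ⟨⟨hb.1, hbN⟩, h⟩
  have hva : ¬ G.Adj v a := fun h => ha.2 ((hN.adj_iff hv hu ha.1.2).1 h)
  rcases hl.not_claw hub.symm ((hN.adj_iff hu hv hbN).1 hub).symm hab.symm huv
    (fun e => ha.1.2 (e ▸ hu)) (fun e => ha.1.2 (e ▸ hv)) with h | h | h
  · exact hadj h
  · exact ha.2 h
  · exact hva h

/-- A twin of `v` outside the module would also be adjacent to a non-neighbour `y` of `v` in `M`,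
and twinship would then join `v` to `y`. -/
theorem trueTwinClass_ssubset {M : Set V} (hM : G.IsModule M)
    (hco : Gᶜ.CutConnected M) (hnt : M.Nontrivial) {v : V} (hv : v ∈ M) :
    G.trueTwinClass v ⊂ M := by
  obtain ⟨y, hy, hyv, hvy⟩ := exists_not_adj hco hnt hv
  have hyT : y ∉ G.trueTwinClass v := fun h =>
    hvy (isClique_trueTwinClass v (mem_trueTwinClass_self v) h hyv.symm)
  refine ⟨fun w hw => ?_, fun h => hyT (h hy)⟩
  by_contra hwM
  have hvw : G.Adj v w := isClique_trueTwinClass v (mem_trueTwinClass_self v) hw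
    fun e => hwM (e ▸ hv)
  have hyw : G.Adj y w := (hM.adj_iff hv hy hwM).1 hvw
  exact hvy ((adj_iff_of_mem_trueTwinClass hw hyv hyw.ne).2 hyw.symm)

theorem subset_trueTwinClass_of_ssubset (hl : G.IsUnitRep l) {M N : Set V}
    (hconn : G.CutConnected M) (hco : Gᶜ.CutConnected M) (hN : G.IsModule N) (hNM : N ⊂ M) {v : V}
    (hv : v ∈ N) : N ⊆ G.trueTwinClass v :=
  hN.subset_trueTwinClass (hl.isClique_of_isModule_ssubset hconn hco hN hNM) hv

theorem isMDChild_trueTwinClass (hl : G.IsUnitRep l) {M : Set V} (hM : G.IsMDNode M)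
    (hconn : G.CutConnected M) (hco : Gᶜ.CutConnected M) (hnt : M.Nontrivial) {v : V}
    (hv : v ∈ M) : G.IsMDChild (G.trueTwinClass v) M := by
  have hss := trueTwinClass_ssubset hM.2.1 hco hnt hv
  have key : ∀ N, G.IsModule N → ∀ x ∈ G.trueTwinClass v, x ∈ N →
      M ⊆ N ∨ N ⊆ G.trueTwinClass v := by
    intro N hN x hx hxN
    rcases hM.subset_or_subset hN (hss.1 hx) hxN with h | h
    · exact Or.inl h
    · rcases h.eq_or_ssubset with h | h
      · exact Or.inl h.symm.subset
      · exact Or.inr (trueTwinClass_eq hx ▸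
          hl.subset_trueTwinClass_of_ssubset hconn hco hN h hxN)
  refine ⟨⟨⟨v, mem_trueTwinClass_self v⟩, isModule_trueTwinClass v, fun N hN => ?_⟩, hM, hss,
    fun P hP hTP => ?_⟩
  · by_cases hd : Disjoint (G.trueTwinClass v) N
    · exact Or.inl hd
    · obtain ⟨x, hx, hxN⟩ := Set.not_disjoint_iff.1 hd
      exact Or.inr ((key N hN x hx hxN).imp_left hss.1.trans)
  · exact (key P hP.2.1 v (mem_trueTwinClass_self v) (hTP.1 (mem_trueTwinClass_self v))).resolve_right
      hTP.2

theorem isMDChild_iff (hl : G.IsUnitRep l) {M : Set V} (hM : G.IsMDNode M)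
    (hconn : G.CutConnected M) (hco : Gᶜ.CutConnected M) (hnt : M.Nontrivial) {N : Set V} :
    G.IsMDChild N M ↔ ∃ v ∈ M, N = G.trueTwinClass v := by
  constructor
  · intro h
    obtain ⟨v, hv⟩ := h.1.1
    exact ⟨v, h.2.2.1.1 hv, h.eq_of_mem
      (hl.isMDChild_trueTwinClass hM hconn hco hnt (h.2.2.1.1 hv)) hv (mem_trueTwinClass_self v)⟩
  · rintro ⟨v, hv, rfl⟩
    exact hl.isMDChild_trueTwinClass hM hconn hco hnt hv

theorem isTwinNode_of_isMDChild (hl : G.IsUnitRep l) {M : Set V} (hM : G.IsMDNode M)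
    (hconn : G.CutConnected M) (hco : Gᶜ.CutConnected M) (hnt : M.Nontrivial) {N : Set V}
    (hN : G.IsMDChild N M) : G.IsTwinNode N := by
  obtain ⟨v, -, rfl⟩ := (hl.isMDChild_iff hM hconn hco hnt).1 hN
  exact ⟨isTrueTwinClass_trueTwinClass v, hN.1.isCliqueNode (isClique_trueTwinClass v)⟩

/-- The union of a module of the quotient is a module of `G`; if it is not all of `M`, it fits into
one twin class, that is, into one child. -/
theorem isPrimeGraph_mdQuotient (hl : G.IsUnitRep l) {M : Set V} (hM : G.IsMDNode M)
    (hconn : G.CutConnected M) (hco : Gᶜ.CutConnected M) (hnt : M.Nontrivial) :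
    (G.mdQuotient M).IsPrimeGraph := by
  intro 𝓜 h𝓜
  rcases 𝓜.eq_empty_or_nonempty with h0 | ⟨A, hA⟩
  · exact Or.inl h0
  refine Or.inr ?_
  have hchild : ∀ z (hz : z ∈ M), G.IsMDChild (G.trueTwinClass z) M := fun z hz =>
    hl.isMDChild_trueTwinClass hM hconn hco hnt hz
  set N : Set V := {x | ∃ A ∈ 𝓜, x ∈ A.1} with hNdef
  have hNM : N ⊆ M := by
    rintro x ⟨A, -, hx⟩
    exact A.2.2.2.1.1 hx
  have hmem : ∀ {B : {N : Set V // G.IsMDChild N M}} {x : V}, x ∈ B.1 → x ∈ N → B ∈ 𝓜 := by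
    rintro B x hx ⟨A, hA, hxA⟩
    have : B = A := Subtype.ext (B.2.eq_of_mem A.2 hx hxA)
    exact this ▸ hA
  have hmod : G.IsModule N := by
    refine isModule_iff.2 ?_
    rintro x ⟨A, hA, hx⟩ y ⟨B, hB, hy⟩ z hz hxz
    by_cases hzM : z ∈ M
    · let C : {N : Set V // G.IsMDChild N M} := ⟨_, hchild z hzM⟩
      have hzC : z ∈ C.1 := mem_trueTwinClass_self z
      have hC : C ∉ 𝓜 := fun h => hz ⟨C, h, hzC⟩
      have hAC : A ≠ C := fun e => hC (e ▸ hA)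
      have hBC : B ≠ C := fun e => hC (e ▸ hB)
      rw [← mdQuotient_adj_iff hAC hx hzC] at hxz
      rw [← mdQuotient_adj_iff hBC hy hzC]
      exact (h𝓜.adj_iff hA hB hC).1 hxz
    · exact (hM.2.1.adj_iff (A.2.2.2.1.1 hx) (B.2.2.2.1.1 hy) hzM).1 hxz
  obtain ⟨x, hx⟩ := A.2.1.1
  rcases hNM.eq_or_ssubset with h | h
  · refine Or.inr (Set.eq_univ_of_forall fun B => ?_)
    obtain ⟨y, hy⟩ := B.2.1.1
    exact hmem hy (h ▸ B.2.2.2.1.1 hy)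
  · refine Or.inl ⟨A, Set.eq_singleton_iff_unique_mem.2 ⟨hA, fun B hB => ?_⟩⟩
    obtain ⟨y, hy⟩ := B.2.1.1
    have hyx := hl.subset_trueTwinClass_of_ssubset hconn hco hmod h ⟨A, hA, hx⟩ ⟨B, hB, hy⟩
    have hxA : A.1 = G.trueTwinClass x :=
      A.2.eq_of_mem (hchild x (hNM ⟨A, hA, hx⟩)) hx (mem_trueTwinClass_self x)
    exact Subtype.ext (B.2.eq_of_mem A.2 hy (hxA ▸ hyx))

/-- Four distinct twin classes come from the extreme vertices `a`, `b` and from neighbours `c`, `d`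
of theirs that see beyond the neighbourhoods of `a` and `b` respectively. -/
theorem four_le_encard_children [Finite V] (hl : G.IsUnitRep l) {M : Set V} (hM : G.IsMDNode M)
    (hconn : G.CutConnected M) (hco : Gᶜ.CutConnected M) (hnt : M.Nontrivial) :
    4 ≤ {N : Set V | G.IsMDChild N M}.encard := by
  obtain ⟨a, ha, hamin⟩ := Set.exists_min_image M l M.toFinite hM.1
  obtain ⟨b, hb, hbmax⟩ := Set.exists_max_image M l M.toFinite hM.1
  have hnear : ∀ x ∈ M, ∃ c ∈ M, G.Adj x c ∧ ∃ y, G.Adj c y ∧ ¬ G.Adj x y ∧ y ≠ x := by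
    intro x hx
    obtain ⟨z, hz, hzx, hxz⟩ := exists_not_adj hco hnt hx
    obtain ⟨c, ⟨hcM, hc⟩, y, ⟨hyM, hy⟩, hcy⟩ := hconn {y | y ∈ M ∧ (y = x ∨ G.Adj x y)}
      (fun y hy => hy.1) ⟨x, hx, Or.inl rfl⟩ ⟨z, hz, by simp [hzx, hxz]⟩
    simp only [Set.mem_ofPred_eq, hyM, true_and, not_or] at hy
    refine ⟨c, hcM, hc.resolve_left ?_, y, hcy, hy.2, hy.1⟩
    rintro rfl
    exact hy.2 hcy
  -- A vertex near both extremes would be adjacent to all the rest of `M`, against co-connectivity.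
  have hno : ∀ w ∈ M, |l w - l a| ≤ 1 → |l w - l b| ≤ 1 → False := by
    intro w hw h1 h2
    obtain ⟨z, hz, hzw, hwz⟩ := exists_not_adj hco hnt hw
    refine hwz ((hl w z).2 ⟨hzw.symm, ?_⟩)
    have := hamin z hz
    have := hbmax z hz
    rw [abs_le] at *
    constructor <;> linarith
  obtain ⟨c, hc, hac, y, hcy, hay, hya⟩ := hnear a ha
  obtain ⟨d, hd, hbd, y', hdy, hby, hyb⟩ := hnear b hb
  have hac' : |l c - l a| ≤ 1 := ((hl _ _).1 hac.symm).2
  have hbd' : |l d - l b| ≤ 1 := ((hl _ _).1 hbd.symm).2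
  have hab : ¬ |l a - l b| ≤ 1 := fun h => hno a ha (by simp) h
  have hcb : ¬ |l c - l b| ≤ 1 := fun h => hno c hc hac' h
  have hda : ¬ |l d - l a| ≤ 1 := fun h => hno d hd h hbd'
  have hcy' : |l c - l y| ≤ 1 := ((hl _ _).1 hcy).2
  have hdy' : |l d - l y'| ≤ 1 := ((hl _ _).1 hdy).2
  have hay' : ¬ |l a - l y| ≤ 1 := fun h => hay ((hl _ _).2 ⟨hya.symm, h⟩)
  have hby' : ¬ |l b - l y'| ≤ 1 := fun h => hby ((hl _ _).2 ⟨hyb.symm, h⟩)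
  have hne : ∀ {u v : V} (z : V), |l u - l z| ≤ 1 → ¬ |l v - l z| ≤ 1 →
      G.trueTwinClass u ≠ G.trueTwinClass v := by
    intro u v z h1 h2 e
    have : v ∈ G.trueTwinClass u := e ▸ mem_trueTwinClass_self v
    exact h2 ((hl.mem_trueTwinClass_iff.1 this z).1 h1)
  have h1 := (hne (u := b) b (by simp) hab).symm
  have h2 := (hne y hcy' hay').symm
  have h3 := hne (u := a) a (by simp) hda
  have h4 := hne (u := b) b (by simp) hcb
  have h5 := (hne y' hdy' hby').symm
  have h6 := hne a hac' hda
  have hcard : ({G.trueTwinClass a, G.trueTwinClass b, G.trueTwinClass c, G.trueTwinClass d} :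
      Set (Set V)).encard = 4 := by
    rw [Set.encard_insert_of_notMem, Set.encard_insert_of_notMem, Set.encard_pair h6]
    · norm_num
    · simp [h4, h5]
    · simp [h1, h2, h3]
  rw [← hcard]
  refine Set.encard_le_encard ?_
  rintro N (rfl | rfl | rfl | rfl) <;>
    exact hl.isMDChild_trueTwinClass hM hconn hco hnt ‹_›

theorem isPrimeNode [Finite V] (hl : G.IsUnitRep l) {M : Set V} (hM : G.IsMDNode M)
    (hconn : G.CutConnected M) (hco : Gᶜ.CutConnected M) (hnt : M.Nontrivial) :
    G.IsPrimeNode M :=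
  ⟨hM, hl.four_le_encard_children hM hconn hco hnt, hl.isPrimeGraph_mdQuotient hM hconn hco hnt⟩

/-! ### The balanced complement of a bipartite chain graph -/

/-- Take for `f a` the leftmost non-neighbour of `a` in `B`: this threshold determines the
neighbours of `a` in `B`, while inside `A` and outside `M` all vertices of `A` have the same closed
neighbours. -/
theorem exists_twin_reflecting_map [Finite V] (hl : G.IsUnitRep l) {M A B : Set V}
    (hM : G.IsModule M) (hAB : M = A ∪ B) (hA : G.IsClique A) (hle : ∀ a ∈ A, ∀ b ∈ B, l a ≤ l b)
    (hnon : ∀ a ∈ A, ∃ b ∈ B, ¬ |l a - l b| ≤ 1) :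
    ∃ f : V → V, (∀ a ∈ A, f a ∈ B) ∧ ∀ a ∈ A, ∀ a' ∈ A,
      f a' ∈ G.trueTwinClass (f a) → a' ∈ G.trueTwinClass a := by
  have hmin : ∀ a ∈ A, ∃ b, (b ∈ B ∧ ¬ |l a - l b| ≤ 1) ∧
      ∀ b' ∈ B, ¬ |l a - l b'| ≤ 1 → l b ≤ l b' := by
    intro a ha
    obtain ⟨b, hb, h⟩ := Set.exists_min_image {b | b ∈ B ∧ ¬ |l a - l b| ≤ 1} l (Set.toFinite _)
      (hnon a ha)
    exact ⟨b, hb, fun b' h1 h2 => h b' ⟨h1, h2⟩⟩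
  choose! f hf hfmin using hmin
  refine ⟨f, fun a ha => (hf a ha).1, ?_⟩
  have key : ∀ a ∈ A, ∀ a' ∈ A, l a ≤ l a' → f a' ∈ G.trueTwinClass (f a) →
      a' ∈ G.trueTwinClass a := by
    intro a ha a' ha' haa' ht
    rw [hl.mem_trueTwinClass_iff] at ht ⊢
    have hcl : ∀ x ∈ A, ∀ y ∈ A, |l x - l y| ≤ 1 := by
      intro x hx y hy
      by_cases hxy : x = y
      · simp [hxy]
      · exact ((hl x y).1 (hA hx hy hxy)).2
    intro z
    by_cases hzM : z ∈ M
    · rcases hAB ▸ hzM with hz | hz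
      · simp [hcl a ha z hz, hcl a' ha' z hz]
      · have h1 := hle a ha z hz
        have h2 := hle a' ha' z hz
        constructor
        · intro h
          rw [abs_le] at h ⊢
          constructor <;> linarith
        · intro h
          by_contra h'
          have h3 := hfmin a ha z hz h'
          -- Since `f a` is not to the right of `z`, it is near `a'`; its twin `f a'` would then be
          -- near `a'` too.
          have h4 : |l (f a) - l a'| ≤ 1 := by
            have := hle a' ha' _ (hf a ha).1
            rw [abs_le] at h ⊢
            constructor <;> linarith
          have h5 := (ht a').1 h4
          rw [abs_sub_comm] at h5
          exact (hf a' ha').2 h5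
    · have h1 : a ≠ z := fun e => hzM (e ▸ hAB ▸ Or.inl ha)
      have h2 : a' ≠ z := fun e => hzM (e ▸ hAB ▸ Or.inl ha')
      have := hM.adj_iff (x := a) (y := a') (hAB ▸ Or.inl ha) (hAB ▸ Or.inl ha') hzM
      simpa [hl _ _, h1, h2] using this
  intro a ha a' ha' ht
  rcases le_total (l a) (l a') with h | h
  · exact key a ha a' ha' h ht
  · have := key a' ha' a ha h (trueTwinClass_eq ht ▸ mem_trueTwinClass_self (f a))
    exact trueTwinClass_eq this ▸ mem_trueTwinClass_self a'

theorem encard_image_trueTwinClass_le [Finite V] (hl : G.IsUnitRep l) {M A B : Set V}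
    (hM : G.IsModule M) (hAB : M = A ∪ B) (hA : G.IsClique A) (hle : ∀ a ∈ A, ∀ b ∈ B, l a ≤ l b)
    (hnon : ∀ a ∈ A, ∃ b ∈ B, ¬ |l a - l b| ≤ 1) :
    (G.trueTwinClass '' A).encard ≤ (G.trueTwinClass '' B).encard := by
  obtain ⟨f, hfB, hf⟩ := hl.exists_twin_reflecting_map hM hAB hA hle hnon
  rcases A.eq_empty_or_nonempty with rfl | ⟨a₀, -⟩
  · simp
  have : Nonempty V := ⟨a₀⟩
  have hrep : ∀ N ∈ G.trueTwinClass '' A, ∃ a ∈ A, G.trueTwinClass a = N := fun N hN => hN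
  choose! r hrA hr using hrep
  refine Set.encard_le_encard_of_injOn (f := fun N => G.trueTwinClass (f (r N)))
    (fun N hN => ⟨_, hfB _ (hrA N hN), rfl⟩) fun N hN N' hN' h => ?_
  have h1 : f (r N') ∈ G.trueTwinClass (f (r N)) := by
    have h2 : G.trueTwinClass (f (r N)) = G.trueTwinClass (f (r N')) := h
    exact h2 ▸ mem_trueTwinClass_self _
  have := trueTwinClass_eq (hf _ (hrA N hN) _ (hrA N' hN') h1)
  rw [← hr N hN, ← hr N' hN', this]

theorem isBalancedCoBipartiteChain_mdQuotient [Finite V] (hl : G.IsUnitRep l) {M : Set V}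
    (hM : G.IsMDNode M) (hconn : G.CutConnected M) (hco : Gᶜ.CutConnected M)
    (hnt : M.Nontrivial) {u : V} (hu : ∀ x ∈ M, G.Adj u x) :
    (G.mdQuotient M).IsBalancedCoBipartiteChain := by
  have hu' : ∀ x ∈ M, |l u - l x| ≤ 1 := fun x hx => ((hl u x).1 (hu x hx)).2
  have hfar : ∀ x ∈ M, ∃ y ∈ M, ¬ |l x - l y| ≤ 1 := by
    intro x hx
    obtain ⟨y, hy, hyx, hxy⟩ := exists_not_adj hco hnt hx
    exact ⟨y, hy, fun h => hxy ((hl x y).2 ⟨hyx.symm, h⟩)⟩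
  -- All of `M` lies within 1 of `l u`, so each side of `l u` spans at most length 1 and is a
  -- clique.
  set A : Set V := {x | x ∈ M ∧ l x ≤ l u} with hAdef
  set B : Set V := {x | x ∈ M ∧ l u < l x} with hBdef
  have hMAB : M = A ∪ B := by
    ext x
    simp only [hAdef, hBdef, Set.mem_union, Set.mem_ofPred_eq, ← and_or_left, le_or_gt, and_true]
  have hAc : ∀ x ∈ A, ∀ y ∈ A, |l x - l y| ≤ 1 := by
    rintro x ⟨hx, hx'⟩ y ⟨hy, hy'⟩
    have h1 := hu' x hx
    have h2 := hu' y hy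
    rw [abs_le] at *
    constructor <;> linarith
  have hBc : ∀ x ∈ B, ∀ y ∈ B, |l x - l y| ≤ 1 := by
    rintro x ⟨hx, hx'⟩ y ⟨hy, hy'⟩
    have h1 := hu' x hx
    have h2 := hu' y hy
    rw [abs_le] at *
    constructor <;> linarith
  have hle : ∀ a ∈ A, ∀ b ∈ B, l a ≤ l b := fun a ha b hb => ha.2.trans hb.2.le
  have hAnon : ∀ a ∈ A, ∃ b ∈ B, ¬ |l a - l b| ≤ 1 := by
    intro a ha
    obtain ⟨y, hy, hay⟩ := hfar a ha.1
    exact ⟨y, (hMAB ▸ hy : y ∈ A ∪ B).resolve_left fun h => hay (hAc a ha y h), hay⟩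
  have hBnon : ∀ b ∈ B, ∃ a ∈ A, ¬ |l b - l a| ≤ 1 := by
    intro b hb
    obtain ⟨y, hy, hby⟩ := hfar b hb.1
    exact ⟨y, (hMAB ▸ hy : y ∈ A ∪ B).resolve_right fun h => hby (hBc b hb y h), hby⟩
  have hAB : ∀ a ∈ A, ∀ b ∈ B, b ∉ G.trueTwinClass a := by
    intro a ha b hb h
    obtain ⟨y, hy, hay⟩ := hAnon a ha
    exact hay ((hl.mem_trueTwinClass_iff.1 h y).2 (hBc b hb y hy))
  have hchild : ∀ z (hz : z ∈ M), G.IsMDChild (G.trueTwinClass z) M := fun z hz =>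
    hl.isMDChild_trueTwinClass hM hconn hco hnt hz
  have heq : ∀ {N : Set V} {x : V}, G.IsMDChild N M → x ∈ N → N = G.trueTwinClass x :=
    fun hN hx => hN.eq_of_mem (hchild _ (hN.2.2.1.1 hx)) hx (mem_trueTwinClass_self _)
  have hcard : ∀ S ⊆ M, {N : {N : Set V // G.IsMDChild N M} | ∃ x ∈ N.1, x ∈ S}.encard =
      (G.trueTwinClass '' S).encard := by
    intro S hS
    rw [← Subtype.val_injective.encard_image]
    congr 1
    ext N
    constructor
    · rintro ⟨N, ⟨x, hx, hxS⟩, rfl⟩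
      exact ⟨x, hxS, (heq N.2 hx).symm⟩
    · rintro ⟨x, hxS, rfl⟩
      exact ⟨⟨_, hchild x (hS hxS)⟩, ⟨x, mem_trueTwinClass_self x, hxS⟩, rfl⟩
  have hclique : ∀ S : Set V, (∀ x ∈ S, ∀ y ∈ S, |l x - l y| ≤ 1) → G.IsClique S :=
    fun S hS x hx y hy hxy => (hl x y).2 ⟨hxy, hS x hx y hy⟩
  have hclique' : ∀ S : Set V, (∀ x ∈ S, ∀ y ∈ S, |l x - l y| ≤ 1) →
      (G.mdQuotient M).IsClique {N | ∃ x ∈ N.1, x ∈ S} := by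
    rintro S hS N ⟨x, hx, hxS⟩ N' ⟨y, hy, hyS⟩ hne
    refine (mdQuotient_adj_iff hne hx hy).2 (hclique S hS hxS hyS ?_)
    rintro rfl
    exact hne (Subtype.ext (N.2.eq_of_mem N'.2 hx hy))
  refine ⟨{N | ∃ x ∈ N.1, x ∈ A}, {N | ∃ x ∈ N.1, x ∈ B}, ?_, ?_, hclique' A hAc,
    hclique' B hBc, ?_, ?_⟩
  · refine Set.eq_univ_of_forall fun N => ?_
    obtain ⟨x, hx⟩ := N.2.1.1
    exact (hMAB ▸ N.2.2.2.1.1 hx : x ∈ A ∪ B).imp (fun h => ⟨x, hx, h⟩) fun h => ⟨x, hx, h⟩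
  · refine Set.disjoint_left.2 ?_
    rintro N ⟨x, hx, hxA⟩ ⟨y, hy, hyB⟩
    exact hAB x hxA y hyB (heq N.2 hx ▸ hy)
  · rw [hcard A fun x h => h.1, hcard B fun x h => h.1]
    refine le_antisymm
      (hl.encard_image_trueTwinClass_le hM.2.1 hMAB (hclique A hAc) hle hAnon)
      -- Reflecting the line exchanges left and right, giving the opposite inequality.
      (hl.neg.encard_image_trueTwinClass_le hM.2.1 (hMAB.trans (Set.union_comm _ _))
        (hclique B hBc) (fun b hb a ha => neg_le_neg (hle a ha b hb)) fun b hb => ?_)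
    obtain ⟨a, ha, hab⟩ := hBnon b hb
    refine ⟨a, ha, ?_⟩
    rwa [show -l b - -l a = -(l b - l a) by ring, abs_neg]
  · rintro ⟨P, ⟨a, haP, ha⟩, P', ⟨a', haP', ha'⟩, Q, ⟨b, hbQ, hb⟩, Q', ⟨b', hbQ', hb'⟩,
      h1, h2, h3, h4⟩
    have hne : ∀ {P Q : {N : Set V // G.IsMDChild N M}} {a b : V}, a ∈ P.1 → a ∈ A → b ∈ Q.1 →
        b ∈ B → ((G.mdQuotient M).Adj P Q ↔ |l a - l b| ≤ 1) := by
      intro P Q a b haP ha hbQ hb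
      have hPQ : P ≠ Q := by
        rintro rfl
        exact hAB a ha b hb (heq P.2 haP ▸ hbQ)
      have hab : a ≠ b := by
        rintro rfl
        exact hAB a ha a hb (mem_trueTwinClass_self a)
      rw [mdQuotient_adj_iff hPQ haP hbQ, hl a b]
      simp [hab]
    rw [hne haP ha hbQ hb] at h1
    rw [hne haP' ha' hbQ' hb'] at h2
    rw [hne haP ha hbQ' hb'] at h3
    rw [hne haP' ha' hbQ hb] at h4
    have e1 := hle a ha b hb
    have e2 := hle a ha b' hb'
    have e3 := hle a' ha' b hb
    have e4 := hle a' ha' b' hb'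
    rw [abs_le] at h1 h2
    rw [abs_le, not_and_or] at h3 h4
    -- The distances `ab`, `a'b'` and the distances `ab'`, `a'b` have the same sum, yet the first is
    -- at most 2 and the second exceeds 2.
    rcases h3 with h3 | h3 <;> rcases h4 with h4 | h4 <;> linarith

/-! ### Co-disconnected nodes -/

theorem type_of_not_cutConnected_compl [Finite V] (hl : G.IsUnitRep l) {X : Set V}
    (hX : G.IsMDNode X) (hco : ¬ Gᶜ.CutConnected X) :
    G.IsSeriesPrimeType X ∨ G.IsCliqueType X := by
  -- `M` collects the vertices that are not universal in `X`; it will be the only nontrivial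
  -- co-component.
  set M : Set V := {x | x ∈ X ∧ ∃ y ∈ X, y ≠ x ∧ ¬ G.Adj x y} with hMdef
  have hMX : M ⊆ X := fun x hx => hx.1
  have huniv : ∀ x ∈ X \ M, ∀ y ∈ X, y ≠ x → G.Adj x y := by
    intro x hx y hy hyx
    by_contra h
    exact hx.2 ⟨hx.1, y, hy, hyx, h⟩
  rcases M.eq_empty_or_nonempty with hM0 | ⟨m, hm⟩
  · have hcl : G.IsClique X := fun x hx y hy hxy =>
      huniv x ⟨hx, fun h => by simp [hM0] at h⟩ y hy hxy.symm
    exact Or.inr (Or.inl ⟨hcl, hX.isCliqueNode hcl⟩)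
  have hpartner : ∀ x ∈ M, ∃ y ∈ M, y ≠ x ∧ ¬ G.Adj x y := by
    rintro x ⟨hx, y, hy, hyx, hxy⟩
    exact ⟨y, ⟨hy, x, hx, hyx.symm, fun h => hxy h.symm⟩, hyx, hxy⟩
  have hnt : M.Nontrivial := by
    obtain ⟨y, hy, hym, -⟩ := hpartner m hm
    exact ⟨y, hy, m, hm, hym⟩
  have hMco : Gᶜ.CutConnected M := by
    rintro S hS ⟨a, ha⟩ ⟨b, hb⟩
    by_contra! hcon
    have hall : ∀ a ∈ S, ∀ b ∈ M \ S, G.Adj a b := by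
      intro a ha b hb
      by_contra h
      exact hcon a ha b hb ((compl_adj _ _ _).2 ⟨fun e => hb.2 (e ▸ ha), h⟩)
    obtain ⟨a', ha', hne, haa'⟩ := hpartner a (hS ha)
    obtain ⟨b', hb', hne', hbb'⟩ := hpartner b hb.1
    have ha'S : a' ∈ S := by
      by_contra h
      exact haa' (hall a ha a' ⟨ha', h⟩)
    have hb'S : b' ∉ S := fun h => hbb' (hall b' h b hb).symm
    -- A cut of `M` crossed by no non-edge has a nonadjacent pair on each side, hence an induced
    -- 4-cycle.
    rcases hl.not_square (hall a ha b hb) (hall a ha b' ⟨hb', hb'S⟩) (hall a' ha'S b hb)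
      (hall a' ha'S b' ⟨hb', hb'S⟩) hne.symm hne'.symm with h | h
    · exact haa' h
    · exact hbb' h
  obtain ⟨u, hu⟩ : (X \ M).Nonempty := by
    rw [Set.nonempty_iff_ne_empty]
    intro h
    exact hco ((hMX.antisymm (Set.sdiff_eq_empty.1 h)) ▸ hMco)
  have hMss : M ⊂ X := ⟨hMX, fun h => hu.2 (h hu.1)⟩
  have hMchild : G.IsMDChild M X := hX.isMDChild_of_all_edges ⟨m, hm⟩ hMss hMco
    fun a ha b hb => (huniv b hb a ha.1 fun e => hb.2 (e ▸ ha)).symm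
  have hsingle : ∀ v ∈ X \ M, G.IsMDChild {v} X := by
    intro v hv
    refine hX.isMDChild_of_all_edges (Set.singleton_nonempty v)
      ⟨Set.singleton_subset_iff.2 hv.1, fun h => ?_⟩ (cutConnected_of_isClique ?_) ?_
    · exact hv.2 ((h (hMX hm) : m = v) ▸ hm)
    · exact Set.pairwise_singleton _ _
    · rintro a rfl b hb
      exact huniv a hv b hb.1 hb.2
  have hleaf : ∀ N, G.IsMDChild N X → N ≠ M → ∃ v ∈ X \ M, N = {v} := by
    intro N hN hNM
    obtain ⟨v, hv⟩ := hN.1.1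
    have hvM : v ∉ M := fun h => hNM (hN.eq_of_mem hMchild hv h)
    have hvX : v ∈ X \ M := ⟨hN.2.2.1.1 hv, hvM⟩
    exact ⟨v, hvX, hN.eq_of_mem (hsingle v hvX) hv rfl⟩
  have hleaf' : ∀ N, G.IsMDChild N X → N ≠ M → G.IsLeafNode N := by
    intro N hN hNM
    obtain ⟨v, -, h⟩ := hleaf N hN hNM
    exact ⟨hN.1, v, h⟩
  have hclU : G.IsClique (X \ M) := fun x hx y hy hxy => huniv x hx y hy.1 hxy.symm
  have hadj : ∀ P Q : {N : Set V // G.IsMDChild N X}, P ≠ Q → P.1 ≠ M →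
      (G.mdQuotient X).Adj P Q := by
    intro P Q hPQ hP
    obtain ⟨v, hv, hPv⟩ := hleaf P.1 P.2 hP
    have hvP : v ∈ P.1 := hPv ▸ Set.mem_singleton v
    obtain ⟨y, hy⟩ := Q.2.1.1
    refine (mdQuotient_adj_iff hPQ hvP hy).2 (huniv v hv y (Q.2.2.2.1.1 hy) ?_)
    rintro rfl
    exact hPQ (Subtype.ext (P.2.eq_of_mem Q.2 hvP hy))
  have hseries : G.IsSeriesNode X := by
    refine ⟨hX, hnt.mono hMX, ?_⟩
    ext P Q
    rw [top_adj]
    refine ⟨fun h => h.ne, fun hPQ => ?_⟩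
    by_cases hP : P.1 = M
    · exact (hadj Q P hPQ.symm fun hQ => hPQ (Subtype.ext (hP.trans hQ.symm))).symm
    · exact hadj P Q hPQ hP
  have huM : ∀ x ∈ M, G.Adj u x := fun x hx => huniv u hu x hx.1 fun e => hu.2 (e ▸ hx)
  have hMnode := hMchild.1
  by_cases hconn : G.CutConnected M
  · exact Or.inl ⟨hseries, M, hMchild, ⟨hl.isPrimeNode hMnode hconn hMco hnt,
      hl.isBalancedCoBipartiteChain_mdQuotient hMnode hconn hMco hnt huM,
      fun N hN => hl.isTwinNode_of_isMDChild hMnode hconn hMco hnt hN⟩, hleaf', hclU⟩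
  simp only [CutConnected] at hconn
  push Not at hconn
  obtain ⟨S, hS, hS0, hS1, hSno⟩ := hconn
  -- Two nonadjacent vertices on one side and one vertex of the other would form a claw centred at
  -- the universal vertex `u`.
  have hside : ∀ A B : Set V, A ⊆ M → B = M \ A → A.Nonempty → B.Nonempty →
      (∀ a ∈ A, ∀ b ∈ B, ¬ G.Adj a b) → G.IsMDChild A M ∧ G.IsTwinNode A := by
    rintro A B hA rfl ⟨a, ha⟩ ⟨b, hb⟩ hno
    have hcl : G.IsClique A := by
      intro x hx y hy hxy
      rcases hl.not_claw (huM x (hA hx)) (huM y (hA hy)) (huM b hb.1) hxy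
        (fun e => hb.2 (e ▸ hx)) (fun e => hb.2 (e ▸ hy)) with h | h | h
      · exact h
      · exact absurd h (hno x hx b hb)
      · exact absurd h (hno y hy b hb)
    have hch : G.IsMDChild A M := hMnode.isMDChild_of_no_edge ⟨a, ha⟩
      ⟨hA, fun h => hb.2 (h hb.1)⟩ (cutConnected_of_isClique hcl) hno
    refine ⟨hch, ⟨a, ?_⟩, hch.1.isCliqueNode hcl⟩
    refine (hch.1.2.1.subset_trueTwinClass hcl ha).antisymm fun w hw => ?_
    -- A twin of `a` outside `M` is adjacent to `b` as well, since `M` is a module, and twinship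
    -- would join `a` to `b`.
    by_contra hwA
    have haw : G.Adj a w := isClique_trueTwinClass a (mem_trueTwinClass_self a) hw
      fun e => hwA (e ▸ ha)
    have hwM : w ∉ M := fun h => hno a ha w ⟨h, hwA⟩ haw
    have hbw : G.Adj b w := (hMnode.2.1.adj_iff (hA ha) hb.1 hwM).1 haw
    exact hno a ha b hb ((adj_iff_of_mem_trueTwinClass hw (fun e : b = a => hb.2 (e ▸ ha)) hbw.ne).2
      hbw.symm)
  obtain ⟨hc1, ht1⟩ := hside S (M \ S) hS rfl hS0 hS1 hSno
  obtain ⟨hc2, ht2⟩ := hside (M \ S) S Set.sdiff_subset (Set.sdiff_sdiff_cancel_left hS).symm hS1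
    hS0 fun a ha b hb h => hSno b hb a ha h.symm
  have hchildren : ∀ N, G.IsMDChild N M ↔ N = S ∨ N = M \ S := by
    intro N
    constructor
    · intro hN
      obtain ⟨x, hx⟩ := hN.1.1
      by_cases hxS : x ∈ S
      · exact Or.inl (hN.eq_of_mem hc1 hx hxS)
      · exact Or.inr (hN.eq_of_mem hc2 hx ⟨hN.2.2.1.1 hx, hxS⟩)
    · rintro (rfl | rfl)
      · exact hc1
      · exact hc2
  have hSne : S ≠ M \ S := by
    obtain ⟨a, ha⟩ := hS0
    exact fun e => (e ▸ ha : a ∈ M \ S).2 ha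
  refine Or.inr (Or.inr ⟨hseries, M, hMchild, ⟨⟨hMnode, hnt, ?_⟩, ?_, ?_⟩, hleaf', hclU⟩)
  · ext ⟨P, hP⟩ ⟨Q, hQ⟩
    simp only [bot_adj, iff_false]
    rintro ⟨hne, a, ha, b, hb, hab⟩
    rcases (hchildren P).1 hP with rfl | rfl <;> rcases (hchildren Q).1 hQ with rfl | rfl
    · exact hne rfl
    · exact hSno a ha b hb hab
    · exact hSno b hb a ha hab.symm
    · exact hne rfl
  · rw [← Set.encard_pair hSne]
    congr 1
    ext N
    exact hchildren N
  · intro N hN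
    rcases (hchildren N).1 hN with rfl | rfl
    · exact ht1
    · exact ht2

theorem type_of_isMDNode [Finite V] (hl : G.IsUnitRep l) {X : Set V} (hX : G.IsMDNode X)
    (hconn : G.CutConnected X) :
    G.IsPrimeType X ∨ G.IsSeriesPrimeType X ∨ G.IsCliqueType X := by
  by_cases hnt : X.Nontrivial
  · by_cases hco : Gᶜ.CutConnected X
    · exact Or.inl ⟨hl.isPrimeNode hX hconn hco hnt,
        fun N hN => hl.isTwinNode_of_isMDChild hX hconn hco hnt hN⟩
    · exact Or.inr (hl.type_of_not_cutConnected_compl hX hco)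
  · have hcl : G.IsClique X := (Set.not_nontrivial_iff.1 hnt).pairwise _
    exact Or.inr (Or.inr (Or.inl ⟨hcl, hX.isCliqueNode hcl⟩))

end IsUnitRep

end SimpleGraph

theorem mainTheorem7 {V : Type*} [Finite V] (G : SimpleGraph V) (hG : G.IsUnitInterval) :
    G.mdDepth ≤ 4 ∧
    (¬ G.Preconnected → G.IsParallelNode Set.univ ∧
      ∀ N : Set V, G.IsMDChild N Set.univ ↔ ∃ C : G.ConnectedComponent, N = C.supp) ∧
    (∀ C : G.ConnectedComponent,
      G.IsPrimeType C.supp ∨ G.IsSeriesPrimeType C.supp ∨ G.IsCliqueType C.supp) := by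
  obtain ⟨l, hl⟩ := hG.exists_isUnitRep
  have htype : ∀ C : G.ConnectedComponent,
      G.IsPrimeType C.supp ∨ G.IsSeriesPrimeType C.supp ∨ G.IsCliqueType C.supp := fun C =>
    hl.type_of_isMDNode (SimpleGraph.isMDNode_supp C) C.cutConnected_supp
  refine ⟨SimpleGraph.mdDepth_le fun x => ?_, fun h => ⟨SimpleGraph.isParallelNode_univ h,
    fun N => SimpleGraph.isMDChild_univ_iff h⟩, htype⟩
  by_cases hpre : G.Preconnected
  · have huniv : (G.connectedComponentMk x).supp = Set.univ :=
      Set.eq_univ_of_forall fun y => SimpleGraph.ConnectedComponent.sound (hpre y x)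
    have := SimpleGraph.encard_mdAncestorsIn_of_type (x := x) (htype (G.connectedComponentMk x))
    rw [huniv] at this
    exact this.trans (by norm_num)
  · have : Nonempty V := ⟨x⟩
    -- The parallel root adds one ancestor to the at most three inside a component.
    refine SimpleGraph.encard_mdAncestorsIn_le (k := 3) SimpleGraph.isMDNode_univ fun C hC _ => ?_
    obtain ⟨D, rfl⟩ := (SimpleGraph.isMDChild_univ_iff hpre).1 hC
    exact SimpleGraph.encard_mdAncestorsIn_of_type (htype D)
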